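/- Let $R$ be a commutative ring and $X,Y\in R$ (for instance two indeterminates in $\mathbb{Z}[X,Y]$, or two real numbers). Let the (Model I) associated Laguerre polynomials $L_n(x)=L_n(x;X,Y)\in R[x]$ be defined by $L_{-1}=0$, $L_0=1$ and $$L_{n+1}(x)=(x-b_n)L_n(x)-\lambda_nL_{n-1}(x),\qquad b_n=2n+X+Y,\quad \lambda_n=(n+X)(n-1+Y).$$ There is exactly one $R$-linear functional $\mathcal L:R[x]\to R$ with $\mathcal L(1)=1$ and $\mathcal L(L_mL_n)=0$ for all $m\neq n$, and its moments $\mu_n=\mathcal L(x^n)$ are, for every $n\ge 0$, $$\mu_n=\sum_{\pi\in\mathfrak S_{n+1}}X^{\mathrm{RLmin}(\pi)-1}\,Y^{\mathrm{LRmax}(\pi)-\mathrm{pivot}(\pi)}.$$ In particular, for real $X,Y$, if $\nu$ is a probability measure on $\mathbb R$ with finite moments of all orders such that $\int L_m L_n\,d\nu=0$ for all $m\ne n$, then $\int t^n\,d\nu(t)$ is given by the same sum for every $n\ge0$. Here, for a permutation $\pi=\pi_1\cdots\pi_{N}$, $\mathrm{RLmin}(\pi)$ is the number of right-to-left minima (letters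 $\pi_i$ with $\pi_i<\pi_j$ for all $j>i$), $\mathrm{LRmax}(\pi)$ is the number of left-to-right maxima (letters $\pi_i$ with $\pi_i>\pi_j$ for all $j<i$), and $\mathrm{pivot}(\pi)$ is the number of letters that are both. -/

import Mathlib

namespace AssocLaguerre

/-- The monic polynomials with `p₋₁ = 0`, `p₀ = 1` and
`pₙ₊₁ = (x - bₙ) pₙ - lamₙ pₙ₋₁`; the value `lam 0` plays no role. -/
noncomputable def orthoPoly {R : Type*} [CommRing R] (b lam : ℕ → R) : ℕ → Polynomial R
  | 0 => 1
  | 1 => Polynomial.X - Polynomial.C (b 0)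
  | n + 2 => (Polynomial.X - Polynomial.C (b (n + 1))) * orthoPoly b lam (n + 1)
      - Polynomial.C (lam (n + 1)) * orthoPoly b lam n

/-- The (Model I) associated Laguerre polynomials `Lₙ(x; X, Y)`. -/
noncomputable def laguerreI {R : Type*} [CommRing R] (X Y : R) : ℕ → Polynomial R :=
  orthoPoly (fun n => 2 * (n : R) + X + Y) (fun n => ((n : R) + X) * ((n : R) - 1 + Y))

/-- `L` is a normalized linear functional with respect to which the polynomials `pₙ` are
orthogonal; its moments `L (xⁿ)` are the moments of the sequence `p`. -/
structure IsMomentFunctional {R : Type*} [CommRing R] (p : ℕ → Polynomial R)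
    (L : Polynomial R →ₗ[R] R) : Prop where
  map_one : L 1 = 1
  orthogonal : ∀ m n : ℕ, m ≠ n → L (p m * p n) = 0

/-- `ν` is a probability measure on the real line with finite moments of all orders with respect
to which the polynomials `pₙ` are orthogonal. -/
structure IsOrthogonalityMeasure (p : ℕ → Polynomial ℝ) (ν : MeasureTheory.Measure ℝ) : Prop where
  isProbabilityMeasure : MeasureTheory.IsProbabilityMeasure ν
  integrable : ∀ n : ℕ, MeasureTheory.Integrable (fun t : ℝ => t ^ n) ν
  orthogonal : ∀ m n : ℕ, m ≠ n → ∫ t, (p m).eval t * (p n).eval t ∂ν = 0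

/-- The set of right-to-left minima `πᵢ` of the word `π₁ ⋯ πₙ`
(positions and letters are numbered from `0`). -/
def RLMIN {n : ℕ} (π : Equiv.Perm (Fin n)) : Finset (Fin n) :=
  (Finset.univ.filter fun i => ∀ j, i < j → π i < π j).map π.toEmbedding

/-- The set of left-to-right maxima `πᵢ` of the word `π₁ ⋯ πₙ`. -/
def LRMAX {n : ℕ} (π : Equiv.Perm (Fin n)) : Finset (Fin n) :=
  (Finset.univ.filter fun i => ∀ j, j < i → π j < π i).map π.toEmbedding

/-- The number of right-to-left minima. -/
def RLmin {n : ℕ} (π : Equiv.Perm (Fin n)) : ℕ := (RLMIN π).card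

/-- The number of left-to-right maxima. -/
def LRmax {n : ℕ} (π : Equiv.Perm (Fin n)) : ℕ := (LRMAX π).card

/-- The number of pivots: letters that are both a left-to-right maximum and a
right-to-left minimum. -/
def pivot {n : ℕ} (π : Equiv.Perm (Fin n)) : ℕ := (LRMAX π ∩ RLMIN π).card

/-- The subtraction `LRmax π - pivot π` does not truncate. -/
theorem pivot_le_LRmax {n : ℕ} (π : Equiv.Perm (Fin n)) : pivot π ≤ LRmax π :=
  Finset.card_le_card Finset.inter_subset_left

/-- The subtraction `RLmin π - 1` does not truncate on a nonempty word. -/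
theorem one_le_RLmin {n : ℕ} (π : Equiv.Perm (Fin (n + 1))) : 1 ≤ RLmin π := by
  refine Finset.card_pos.mpr ⟨π (Fin.last n), ?_⟩
  simp only [RLMIN, Finset.mem_map, Finset.mem_filter, Finset.mem_univ, true_and]
  exact ⟨Fin.last n, fun j hj => absurd (Fin.le_last j) (not_le.mpr hj), rfl⟩

end AssocLaguerre

/-! Deleting the smallest letter, at position `q`, of a permutation of `n + 1` letters leaves a `σ`
whose right-to-left minima survive exactly at positions `≥ q`. So the permutation sum is `∑ q,
permWeight X Y n q`, and deleting again gives a recursion for `permWeight` (`permWeight_succ`). The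
binomial transform `binomWeight` turns this into a tridiagonal recursion in `k`
(`binomWeight_succ_succ`), with coefficients `k - 1 + Y`, `2 * k + X + Y`, `k + 1 + X`. Up to the
factor `∏ j < k, (j + 1 + X)`, it is the three-term recurrence read on the values `L (xⁿ Lₖ)`, since
`λₖ = (k + X)(k - 1 + Y)`. At `k = 0` these values are the moments. No division occurs, so any
commutative ring will do. -/

namespace AssocLaguerre

open Finset

/-! ### Inserting a smallest letter into a permutation -/

/-- Raise all letters of `σ` by one and insert the new smallest letter at position `q`. -/
def insertMin {n : ℕ} (q : Fin (n + 1)) (σ : Equiv.Perm (Fin n)) : Equiv.Perm (Fin (n + 1)) :=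
  (finSuccEquiv' q).trans ((Equiv.optionCongr σ).trans (finSuccEquiv' 0).symm)

theorem insertMin_self {n : ℕ} (q : Fin (n + 1)) (σ : Equiv.Perm (Fin n)) :
    insertMin q σ q = 0 := by
  simp [insertMin]

theorem insertMin_succAbove {n : ℕ} (q : Fin (n + 1)) (σ : Equiv.Perm (Fin n)) (i : Fin n) :
    insertMin q σ (q.succAbove i) = (σ i).succ := by
  simp [insertMin]

theorem insertMin_bijective (n : ℕ) :
    Function.Bijective
      (fun x : Fin (n + 1) × Equiv.Perm (Fin n) => insertMin x.1 x.2) := by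
  rw [Fintype.bijective_iff_injective_and_card]
  constructor
  · rintro ⟨q, σ⟩ ⟨q', σ'⟩ h
    simp only at h
    have hq : q = q' := by
      apply (insertMin q' σ').injective
      rw [insertMin_self, ← h, insertMin_self]
    subst hq
    have hσ : σ = σ' := by
      ext1 i
      apply Fin.succ_injective
      rw [← insertMin_succAbove q, ← insertMin_succAbove q, h]
    rw [hσ]
  · simp [Fintype.card_perm, Nat.factorial_succ]

theorem sum_perm_fin_succ {M : Type*} [AddCommMonoid M] {n : ℕ}
    (f : Equiv.Perm (Fin (n + 1)) → M) :
    ∑ π, f π = ∑ q : Fin (n + 1), ∑ σ : Equiv.Perm (Fin n), f (insertMin q σ) := by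
  rw [← (insertMin_bijective n).sum_comp, Fintype.sum_prod_type]

/-- The letter at position `i` is a right-to-left minimum. -/
def IsRLMinAt {n : ℕ} (π : Equiv.Perm (Fin n)) (i : Fin n) : Prop :=
  ∀ j, i < j → π i < π j

/-- The letter at position `i` is a left-to-right maximum. -/
def IsLRMaxAt {n : ℕ} (π : Equiv.Perm (Fin n)) (i : Fin n) : Prop :=
  ∀ j, j < i → π j < π i

instance {n : ℕ} (π : Equiv.Perm (Fin n)) : DecidablePred (IsRLMinAt π) :=
  fun i => inferInstanceAs (Decidable (∀ j, i < j → π i < π j))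

instance {n : ℕ} (π : Equiv.Perm (Fin n)) : DecidablePred (IsLRMaxAt π) :=
  fun i => inferInstanceAs (Decidable (∀ j, j < i → π j < π i))

section InsertMin

variable {n : ℕ} (q : Fin (n + 1)) (σ : Equiv.Perm (Fin n))

theorem isRLMinAt_insertMin_self : IsRLMinAt (insertMin q σ) q := by
  intro j hj
  obtain ⟨i, rfl⟩ := Fin.exists_succAbove_eq hj.ne'
  rw [insertMin_self, insertMin_succAbove]
  exact Fin.succ_pos _

theorem isLRMaxAt_insertMin_self : IsLRMaxAt (insertMin q σ) q ↔ q = 0 := by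
  constructor
  · intro h
    by_contra hq
    have := h 0 (Fin.pos_of_ne_zero hq)
    rw [insertMin_self] at this
    exact absurd this (Fin.not_lt_zero _)
  · rintro rfl j hj
    exact absurd hj (Fin.not_lt_zero _)

/-- The new smallest letter destroys every right-to-left minimum on its left and none on its right.
-/
theorem isRLMinAt_insertMin_succAbove (i : Fin n) :
    IsRLMinAt (insertMin q σ) (q.succAbove i) ↔ (q : ℕ) ≤ i ∧ IsRLMinAt σ i := by
  constructor
  · intro h
    constructor
    · by_contra hi
      have hlt : q.succAbove i < q :=
        Fin.succAbove_lt_iff_castSucc_lt _ _ |>.mpr (by simpa [Fin.lt_def] using hi)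
      have := h q hlt
      rw [insertMin_self] at this
      exact absurd this (Fin.not_lt_zero _)
    · intro j hj
      have := h (q.succAbove j) (Fin.succAbove_lt_succAbove_iff.mpr hj)
      simpa [insertMin_succAbove] using this
  · rintro ⟨hi, h⟩ j hj
    have hlt : q < q.succAbove i :=
      Fin.lt_succAbove_iff_le_castSucc _ _ |>.mpr (by simpa [Fin.le_def] using hi)
    obtain ⟨j, rfl⟩ := Fin.exists_succAbove_eq (hlt.trans hj).ne'
    rw [insertMin_succAbove, insertMin_succAbove, Fin.succ_lt_succ_iff]
    exact h j (Fin.succAbove_lt_succAbove_iff.mp hj)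

theorem isLRMaxAt_insertMin_succAbove (i : Fin n) :
    IsLRMaxAt (insertMin q σ) (q.succAbove i) ↔ IsLRMaxAt σ i := by
  constructor
  · intro h j hj
    have := h (q.succAbove j) (Fin.succAbove_lt_succAbove_iff.mpr hj)
    simpa [insertMin_succAbove] using this
  · intro h j hj
    rcases eq_or_ne j q with rfl | hjq
    · rw [insertMin_self, insertMin_succAbove]
      exact Fin.succ_pos _
    · obtain ⟨j, rfl⟩ := Fin.exists_succAbove_eq hjq
      rw [insertMin_succAbove, insertMin_succAbove, Fin.succ_lt_succ_iff]
      exact h j (Fin.succAbove_lt_succAbove_iff.mp hj)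

theorem le_succAbove_val_iff (p : ℕ) (i : Fin n) :
    p ≤ (q.succAbove i : ℕ) ∧ (q : ℕ) ≤ i ↔ max p (q + 1) ≤ (i : ℕ) + 1 := by
  rcases lt_or_ge (i : ℕ) q with h | h
  · omega
  · rw [Fin.succAbove_of_le_castSucc q i (by simpa [Fin.le_def] using h)]
    simp only [Fin.val_succ]
    omega

end InsertMin

/-! ### Statistics restricted to the positions from `p` on -/

/-- The number of right-to-left minima at positions `≥ p`. -/
def rlMinFrom {n : ℕ} (π : Equiv.Perm (Fin n)) (p : ℕ) : ℕ :=
  #{i : Fin n | p ≤ i ∧ IsRLMinAt π i}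

/-- The number of left-to-right maxima that are not right-to-left minima at positions `≥ p`. -/
def lrMaxBut {n : ℕ} (π : Equiv.Perm (Fin n)) (p : ℕ) : ℕ :=
  #{i : Fin n | IsLRMaxAt π i ∧ ¬ (p ≤ i ∧ IsRLMinAt π i)}

theorem RLmin_eq_rlMinFrom {n : ℕ} (π : Equiv.Perm (Fin n)) : RLmin π = rlMinFrom π 0 := by
  simp [RLmin, RLMIN, rlMinFrom, IsRLMinAt]

theorem LRmax_sub_pivot {n : ℕ} (π : Equiv.Perm (Fin n)) :
    LRmax π - pivot π = lrMaxBut π 0 := by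
  rw [LRmax, pivot, ← card_sdiff_add_card_inter (LRMAX π) (RLMIN π), Nat.add_sub_cancel, LRMAX,
    RLMIN, ← Finset.map_sdiff, card_map, lrMaxBut]
  congr 1
  ext i
  simp [IsRLMinAt, IsLRMaxAt]

theorem card_filter_fin_succAbove {n : ℕ} (q : Fin (n + 1)) (P : Fin (n + 1) → Prop)
    [DecidablePred P] :
    #{i | P i} = (if P q then 1 else 0) + #{i : Fin n | P (q.succAbove i)} := by
  simp only [card_filter]
  exact Fin.sum_univ_succAbove _ q

/-- Two cutoffs, `p` and the insertion position, merge into the stronger one; `p - 1` accounts for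
the position removed before `p`. -/
theorem rlMinFrom_insertMin {n : ℕ} (q : Fin (n + 1)) (σ : Equiv.Perm (Fin n)) (p : ℕ) :
    rlMinFrom (insertMin q σ) p =
      if p ≤ q then rlMinFrom σ q + 1 else rlMinFrom σ (p - 1) := by
  rw [rlMinFrom, card_filter_fin_succAbove q]
  have key (i : Fin n) : (p ≤ (q.succAbove i : ℕ) ∧ IsRLMinAt (insertMin q σ) (q.succAbove i)) ↔
      max p (q + 1) ≤ (i : ℕ) + 1 ∧ IsRLMinAt σ i := by
    rw [isRLMinAt_insertMin_succAbove, ← and_assoc, le_succAbove_val_iff]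
  simp only [key, isRLMinAt_insertMin_self, and_true, rlMinFrom]
  split_ifs with h
  · rw [add_comm]
    congr 3
    ext i
    refine and_congr_left fun _ => ?_
    omega
  · rw [zero_add]
    congr 2
    ext i
    refine and_congr_left fun _ => ?_
    omega

/-- The inserted letter itself contributes only when `q = 0 < p`: it is then a left-to-right maximum
whose right-to-left minimality the cutoff hides. -/
theorem lrMaxBut_insertMin {n : ℕ} (q : Fin (n + 1)) (σ : Equiv.Perm (Fin n)) (p : ℕ) :
    lrMaxBut (insertMin q σ) p =
      if p ≤ q then lrMaxBut σ q else lrMaxBut σ (p - 1) + if (q : ℕ) = 0 then 1 else 0 := by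
  rw [lrMaxBut, card_filter_fin_succAbove q]
  have key (i : Fin n) : (p ≤ (q.succAbove i : ℕ) ∧ IsRLMinAt (insertMin q σ) (q.succAbove i)) ↔
      max p (q + 1) ≤ (i : ℕ) + 1 ∧ IsRLMinAt σ i := by
    rw [isRLMinAt_insertMin_succAbove, ← and_assoc, le_succAbove_val_iff]
  simp only [key, isRLMinAt_insertMin_self, and_true, isLRMaxAt_insertMin_self,
    isLRMaxAt_insertMin_succAbove, lrMaxBut, Fin.ext_iff, Fin.val_zero]
  split_ifs
  all_goals try omega
  · rw [add_comm]
    congr 3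
    ext i
    refine and_congr_right fun _ => not_congr (and_congr_left fun _ => ?_)
    omega
  · rw [zero_add]
    congr 2
    ext i
    refine and_congr_right fun _ => not_congr (and_congr_left fun _ => ?_)
    omega
  · rw [zero_add, add_zero]
    congr 2
    ext i
    refine and_congr_right fun _ => not_congr (and_congr_left fun _ => ?_)
    omega

/-! ### Weights of permutations and their binomial transform -/

section Weights

variable {R : Type*} [CommRing R] (X Y : R)

/-- The total weight of the permutations of `n` letters, where only right-to-left minima at
positions `≥ p` are taken into account. -/
def permWeight (n p : ℕ) : R :=
  ∑ σ : Equiv.Perm (Fin n), X ^ rlMinFrom σ p * Y ^ lrMaxBut σ p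

theorem sum_perm_eq_sum_permWeight (n : ℕ) :
    ∑ π : Equiv.Perm (Fin (n + 1)), X ^ (RLmin π - 1) * Y ^ (LRmax π - pivot π) =
      ∑ q ∈ range (n + 1), permWeight X Y n q := by
  simp only [RLmin_eq_rlMinFrom, LRmax_sub_pivot]
  rw [sum_perm_fin_succ, ← Fin.sum_univ_eq_sum_range]
  simp [rlMinFrom_insertMin, lrMaxBut_insertMin, permWeight]

theorem permWeight_zero : permWeight X Y 0 0 = 1 := by
  simp [permWeight, rlMinFrom, lrMaxBut]

theorem permWeight_succ (n p : ℕ) :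
    permWeight X Y (n + 1) p = ∑ q ∈ range (n + 1),
      if p ≤ q then X * permWeight X Y n q
        else (if q = 0 then Y else 1) * permWeight X Y n (p - 1) := by
  rw [permWeight, sum_perm_fin_succ, ← Fin.sum_univ_eq_sum_range (fun q =>
    if p ≤ q then X * permWeight X Y n q
        else (if q = 0 then Y else 1) * permWeight X Y n (p - 1))]
  refine sum_congr rfl fun q _ => ?_
  simp only [rlMinFrom_insertMin, lrMaxBut_insertMin, permWeight]
  split_ifs
  all_goals
    rw [mul_sum]
    refine sum_congr rfl fun σ _ => ?_
    ring

theorem permWeight_succ_zero (n : ℕ) :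
    permWeight X Y (n + 1) 0 = X * ∑ q ∈ range (n + 1), permWeight X Y n q := by
  simp [permWeight_succ, mul_sum]

theorem permWeight_succ_succ {n p : ℕ} (hp : p ≤ n) :
    permWeight X Y (n + 1) (p + 1) =
      X * (∑ q ∈ range (n + 1), if p + 1 ≤ q then permWeight X Y n q else 0) +
        (Y + p) * permWeight X Y n p := by
  -- Insertion at `q = 0` yields `Y`, and each of `q = 1, …, p` yields `1`.
  have hY : ∑ q ∈ range (n + 1), (if p + 1 ≤ q then 0 else if q = 0 then Y else 1) = Y + p := by
    rw [← sum_subset (range_subset_range.mpr (Nat.succ_le_succ hp)), sum_range_succ']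
    · have : ∀ q ∈ range p, (if p + 1 ≤ q + 1 then 0 else if q + 1 = 0 then Y else 1) = 1 := by
        intro q hq
        rw [if_neg (by simpa using hq), if_neg (Nat.succ_ne_zero q)]
      rw [sum_congr rfl this]
      simp [add_comm]
    · intro q _ hq
      rw [if_pos (by simpa using hq)]
  rw [permWeight_succ, ← hY, mul_sum, sum_mul, ← sum_add_distrib]
  refine sum_congr rfl fun q _ => ?_
  split_ifs <;> simp

/-- The binomial transform of the weights of the permutations of `n` letters. -/
def binomWeight (n k : ℕ) : R :=
  ∑ p ∈ range (n + 1), (p.choose k : R) * permWeight X Y n p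

theorem binomWeight_zero (k : ℕ) : binomWeight X Y 0 k = if k = 0 then 1 else 0 := by
  cases k <;> simp [binomWeight, permWeight_zero]

theorem binomWeight_of_lt {n k : ℕ} (h : n < k) : binomWeight X Y n k = 0 := by
  refine sum_eq_zero fun p hp => ?_
  rw [Nat.choose_eq_zero_of_lt (by simp at hp; omega), Nat.cast_zero, zero_mul]

theorem binomWeight_zero_right (n : ℕ) :
    binomWeight X Y n 0 =
      ∑ π : Equiv.Perm (Fin (n + 1)), X ^ (RLmin π - 1) * Y ^ (LRmax π - pivot π) := by
  simp [sum_perm_eq_sum_permWeight, binomWeight]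

theorem sum_range_succ_choose (q k : ℕ) :
    ∑ p ∈ range (q + 1), p.choose k = (q + 1).choose (k + 1) := by
  induction q with
  | zero => cases k <;> simp [Nat.choose_eq_zero_of_lt]
  | succ q ih => rw [sum_range_succ, ih, Nat.choose_succ_succ (q + 1) k, add_comm]

/-- Exchanging the sums over `p` and `q` leaves `∑ p ≤ q, p.choose k`, which the hockey-stick
identity evaluates. -/
theorem binomWeight_succ_eq_sum (n k : ℕ) :
    binomWeight X Y (n + 1) k = ∑ q ∈ range (n + 1),
      (X * ((q + 1).choose (k + 1) : ℕ) + (Y + q) * ((q + 1).choose k : ℕ)) *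
        permWeight X Y n q := by
  have h1 : ∀ p ∈ range (n + 2), (p.choose k : R) * permWeight X Y (n + 1) p =
      (∑ q ∈ range (n + 1), if p ≤ q then X * p.choose k * permWeight X Y n q else 0) +
        p.choose k * (if p = 0 then 0 else (Y + (p - 1 : ℕ)) * permWeight X Y n (p - 1)) := by
    intro p hp
    cases p with
    | zero =>
      rw [permWeight_succ_zero]
      simp only [mul_sum, Nat.zero_le, if_true, mul_zero, add_zero]
      exact sum_congr rfl fun q _ => by ring
    | succ p =>
      rw [permWeight_succ_succ X Y (by simp at hp; omega), if_neg (Nat.succ_ne_zero p),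
        Nat.add_sub_cancel, mul_add]
      simp only [mul_sum]
      congr 1
      refine sum_congr rfl fun q _ => ?_
      split_ifs
      · ring
      · simp
  rw [binomWeight, sum_congr rfl h1, sum_add_distrib, sum_comm, sum_range_succ' _ (n + 1),
    if_pos rfl, mul_zero, add_zero, ← sum_add_distrib]
  refine sum_congr rfl fun q hq => ?_
  rw [if_neg (Nat.succ_ne_zero q), Nat.add_sub_cancel, add_mul (X * _)]
  congr 1
  · rw [← sum_range_succ_choose, ← sum_filter]
    have : (range (n + 2)).filter (fun p => p ≤ q) = range (q + 1) := by
      ext p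
      simp only [mem_filter, mem_range] at hq ⊢
      omega
    rw [this, Nat.cast_sum, mul_sum, sum_mul]
  · ring

theorem mul_cast_choose (q k : ℕ) :
    (q : R) * q.choose k = (k + 1) * q.choose (k + 1) + k * q.choose k := by
  have h : q * q.choose k = (k + 1) * q.choose (k + 1) + k * q.choose k := by
    rcases le_or_gt k q with hk | hk
    · have := Nat.choose_succ_right_eq q k
      obtain ⟨d, rfl⟩ := Nat.exists_eq_add_of_le hk
      rw [Nat.add_sub_cancel_left] at this
      linarith
    · simp [Nat.choose_eq_zero_of_lt hk, Nat.choose_eq_zero_of_lt (Nat.lt_succ_of_lt hk)]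
  exact_mod_cast congrArg (Nat.cast : ℕ → R) h

theorem binomWeight_succ_zero (n : ℕ) :
    binomWeight X Y (n + 1) 0 =
      (X + Y) * binomWeight X Y n 0 + (1 + X) * binomWeight X Y n 1 := by
  rw [binomWeight_succ_eq_sum, binomWeight, binomWeight, mul_sum, mul_sum, ← sum_add_distrib]
  refine sum_congr rfl fun q _ => ?_
  simp
  ring

theorem binomWeight_succ_succ (n k : ℕ) :
    binomWeight X Y (n + 1) (k + 1) =
      (k + Y) * binomWeight X Y n k + (2 * (k + 1) + X + Y) * binomWeight X Y n (k + 1) +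
        (k + 2 + X) * binomWeight X Y n (k + 2) := by
  rw [binomWeight_succ_eq_sum, binomWeight, binomWeight, binomWeight, mul_sum, mul_sum, mul_sum,
    ← sum_add_distrib, ← sum_add_distrib]
  refine sum_congr rfl fun q _ => ?_
  have h1 := mul_cast_choose (R := R) q k
  have h2 := mul_cast_choose (R := R) q (k + 1)
  rw [Nat.choose_succ_succ' q k, Nat.choose_succ_succ' q (k + 1)]
  push_cast at h1 h2 ⊢
  -- After Pascal's rule, the terms `q * q.choose k` and `q * q.choose (k + 1)` are all that remain
  -- to be rewritten.
  linear_combination permWeight X Y n q * (h1 + h2)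

end Weights

/-! ### Moment functionals -/

section Functional

variable {R : Type*} [CommRing R]

theorem orthoPoly_natDegree_le (b lam : ℕ → R) (n : ℕ) : (orthoPoly b lam n).natDegree ≤ n := by
  induction n using Nat.twoStepInduction with
  | zero => simp [orthoPoly]
  | one => simpa [orthoPoly] using Polynomial.natDegree_X_sub_C_le (b 0)
  | more n ih0 ih1 =>
    rw [orthoPoly]
    refine (Polynomial.natDegree_sub_le _ _).trans (max_le ?_ ?_)
    · refine Polynomial.natDegree_mul_le.trans ?_
      have := Polynomial.natDegree_X_sub_C_le (b (n + 1))
      omega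
    · exact (Polynomial.natDegree_C_mul_le _ _).trans (by omega)

variable (X Y : R)

theorem X_pow_succ_mul_laguerreI_zero (n : ℕ) :
    (Polynomial.X ^ (n + 1) * laguerreI X Y 0 : Polynomial R) =
      Polynomial.X ^ n * laguerreI X Y 1 + (X + Y) • (Polynomial.X ^ n * laguerreI X Y 0) := by
  simp only [laguerreI, orthoPoly, Polynomial.smul_eq_C_mul]
  simp
  ring

theorem X_pow_succ_mul_laguerreI_succ (n k : ℕ) :
    (Polynomial.X ^ (n + 1) * laguerreI X Y (k + 1) : Polynomial R) =
      Polynomial.X ^ n * laguerreI X Y (k + 2) +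
        (2 * (k + 1) + X + Y) • (Polynomial.X ^ n * laguerreI X Y (k + 1)) +
        ((k + 1 + X) * (k + Y)) • (Polynomial.X ^ n * laguerreI X Y k) := by
  simp only [laguerreI, orthoPoly, Polynomial.smul_eq_C_mul]
  simp
  ring

variable {X Y}

/-- The values of a functional on `xⁿ Lₖ` when its moments are the binomial sums. -/
theorem map_X_pow_mul_laguerreI {L : Polynomial R →ₗ[R] R}
    (hL : ∀ n, L (Polynomial.X ^ n) = binomWeight X Y n 0) (k n : ℕ) :
    L (Polynomial.X ^ n * laguerreI X Y k) =
      (∏ j ∈ range k, ((j : R) + 1 + X)) * binomWeight X Y n k := by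
  induction k using Nat.twoStepInduction generalizing n with
  | zero => simp [laguerreI, orthoPoly, hL]
  | one =>
    have h := congrArg L (X_pow_succ_mul_laguerreI_zero X Y n)
    have h0 (m : ℕ) : L (Polynomial.X ^ m * laguerreI X Y 0) = binomWeight X Y m 0 := by
      simp [laguerreI, orthoPoly, hL]
    rw [map_add, map_smul, h0, h0, binomWeight_succ_zero, smul_eq_mul] at h
    simp only [range_one, prod_singleton, Nat.cast_zero, zero_add]
    linear_combination -h
  | more k ih0 ih1 =>
    have h := congrArg L (X_pow_succ_mul_laguerreI_succ X Y n k)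
    rw [map_add, map_add, map_smul, map_smul, ih0, ih1, ih1, binomWeight_succ_succ, smul_eq_mul,
      smul_eq_mul] at h
    simp only [prod_range_succ] at h ⊢
    push_cast at h ⊢
    linear_combination -h

/-- Here the induction is on `n`, starting from orthogonality to `L₀ = 1` alone; this forces the
moments and hence uniqueness. -/
theorem IsMomentFunctional.map_X_pow_mul_laguerreI {L : Polynomial R →ₗ[R] R}
    (hL : IsMomentFunctional (laguerreI X Y) L) (n k : ℕ) :
    L (Polynomial.X ^ n * laguerreI X Y k) =
      (∏ j ∈ range k, ((j : R) + 1 + X)) * binomWeight X Y n k := by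
  induction n generalizing k with
  | zero =>
    rw [binomWeight_zero, pow_zero]
    cases k with
    | zero => simp [laguerreI, orthoPoly, hL.map_one]
    | succ k => simpa [laguerreI, orthoPoly] using hL.orthogonal 0 (k + 1) (Nat.succ_ne_zero k).symm
  | succ n ih =>
    cases k with
    | zero =>
      rw [X_pow_succ_mul_laguerreI_zero, map_add, map_smul, ih, ih, binomWeight_succ_zero]
      simp
      ring
    | succ k =>
      rw [X_pow_succ_mul_laguerreI_succ, map_add, map_add, map_smul, map_smul, ih, ih, ih,
        binomWeight_succ_succ]
      simp only [prod_range_succ, smul_eq_mul]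
      push_cast
      ring

theorem IsMomentFunctional.map_X_pow {L : Polynomial R →ₗ[R] R}
    (hL : IsMomentFunctional (laguerreI X Y) L) (n : ℕ) :
    L (Polynomial.X ^ n) = binomWeight X Y n 0 := by
  simpa [laguerreI, orthoPoly] using hL.map_X_pow_mul_laguerreI n 0

/-- Orthogonality comes from the vanishing of `binomWeight X Y i n` for `i < n`, applied to the
monomials of the polynomial of smaller index. -/
theorem isMomentFunctional_of_map_X_pow {L : Polynomial R →ₗ[R] R}
    (hL : ∀ n, L (Polynomial.X ^ n) = binomWeight X Y n 0) :
    IsMomentFunctional (laguerreI X Y) L := by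
  have hlt : ∀ m n, m < n → L (laguerreI X Y m * laguerreI X Y n) = 0 := by
    intro m n hmn
    rw [(laguerreI X Y m).as_sum_range' n
      ((orthoPoly_natDegree_le _ _ m).trans_lt hmn), sum_mul, map_sum]
    refine sum_eq_zero fun i hi => ?_
    rw [← Polynomial.C_mul_X_pow_eq_monomial, ← Polynomial.smul_eq_C_mul, smul_mul_assoc,
      map_smul, AssocLaguerre.map_X_pow_mul_laguerreI hL,
      binomWeight_of_lt X Y (mem_range.mp hi), mul_zero, smul_zero]
  refine ⟨?_, fun m n hmn => ?_⟩
  · simpa [binomWeight_zero] using hL 0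
  · rcases lt_or_gt_of_ne hmn with h | h
    · exact hlt m n h
    · rw [mul_comm]
      exact hlt n m h

theorem existsUnique_isMomentFunctional (X Y : R) :
    ∃! L : Polynomial R →ₗ[R] R, IsMomentFunctional (laguerreI X Y) L := by
  refine ⟨(Polynomial.basisMonomials R).constr R (fun n => binomWeight X Y n 0),
    isMomentFunctional_of_map_X_pow fun n => ?_, fun L hL => ?_⟩
  · rw [Polynomial.X_pow_eq_monomial]
    exact (Polynomial.basisMonomials R).constr_basis R _ n
  · refine (Polynomial.basisMonomials R).ext fun n => ?_
    rw [Module.Basis.constr_basis, Polynomial.coe_basisMonomials]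
    beta_reduce
    rw [← Polynomial.X_pow_eq_monomial, hL.map_X_pow]

end Functional

/-! ### From measures to functionals -/

theorem integrable_polynomial_eval {ν : MeasureTheory.Measure ℝ}
    (h : ∀ n : ℕ, MeasureTheory.Integrable (fun t : ℝ => t ^ n) ν) (p : Polynomial ℝ) :
    MeasureTheory.Integrable (fun t => p.eval t) ν := by
  simp only [Polynomial.eval_eq_sum_range]
  exact MeasureTheory.integrable_finsetSum _ fun i _ => (h i).const_mul _

/-- Integration of polynomials against a measure with finite moments. -/
noncomputable def integralFunctional {ν : MeasureTheory.Measure ℝ}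
    (h : ∀ n : ℕ, MeasureTheory.Integrable (fun t : ℝ => t ^ n) ν) : Polynomial ℝ →ₗ[ℝ] ℝ where
  toFun p := ∫ t, p.eval t ∂ν
  map_add' p q := by
    simp only [Polynomial.eval_add]
    exact MeasureTheory.integral_add (integrable_polynomial_eval h p)
      (integrable_polynomial_eval h q)
  map_smul' c p := by
    simp only [Polynomial.eval_smul, smul_eq_mul, RingHom.id_apply]
    exact MeasureTheory.integral_const_mul c _

theorem IsOrthogonalityMeasure.isMomentFunctional {p : ℕ → Polynomial ℝ}
    {ν : MeasureTheory.Measure ℝ} (h : IsOrthogonalityMeasure p ν) :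
    IsMomentFunctional p (integralFunctional h.integrable) where
  map_one := by
    have := h.isProbabilityMeasure
    simp [integralFunctional]
  orthogonal m n hmn := by
    simpa [integralFunctional] using h.orthogonal m n hmn

end AssocLaguerre

theorem theorem3p6 {R : Type*} [CommRing R] (X Y : R) :
    (∃! L : Polynomial R →ₗ[R] R,
      AssocLaguerre.IsMomentFunctional (AssocLaguerre.laguerreI X Y) L) ∧
    (∀ L : Polynomial R →ₗ[R] R,
      AssocLaguerre.IsMomentFunctional (AssocLaguerre.laguerreI X Y) L →
      ∀ n : ℕ, L (Polynomial.X ^ n) =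
        ∑ π : Equiv.Perm (Fin (n + 1)),
          X ^ (AssocLaguerre.RLmin π - 1) *
            Y ^ (AssocLaguerre.LRmax π - AssocLaguerre.pivot π)) ∧
    (∀ (x y : ℝ) (ν : MeasureTheory.Measure ℝ),
      AssocLaguerre.IsOrthogonalityMeasure (AssocLaguerre.laguerreI x y) ν →
      ∀ n : ℕ, ∫ t, t ^ n ∂ν =
        ∑ π : Equiv.Perm (Fin (n + 1)),
          x ^ (AssocLaguerre.RLmin π - 1) *
            y ^ (AssocLaguerre.LRmax π - AssocLaguerre.pivot π)) := by
  refine ⟨AssocLaguerre.existsUnique_isMomentFunctional X Y, fun L hL n => ?_,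
    fun x y ν hν n => ?_⟩
  · rw [hL.map_X_pow, AssocLaguerre.binomWeight_zero_right]
  · rw [← AssocLaguerre.binomWeight_zero_right, ← hν.isMomentFunctional.map_X_pow]
    simp [AssocLaguerre.integralFunctional]
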